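/- Let $\Sigma$ be a finite nonempty alphabet, and let $\mathrm{Pr}$ be the uniform probability measure on $\Sigma^\omega$, i.e. the measure on the $\sigma$-algebra generated by the cylinder sets with $\mathrm{Pr}\{w : a_1\cdots a_n \text{ is a prefix of } w\} = |\Sigma|^{-n}$ for all $a_1,\dots,a_n\in\Sigma$. Let $\mathcal{A}=(Q,\Sigma,\delta,Q_0,F)$ be a nondeterministic Büchi automaton with finite state set $Q$, transition function $\delta: Q\times\Sigma\to 2^Q$ (extended as usual to sets of states and finite words), initial states $Q_0\subseteq Q$ and final states $F\subseteq Q$. Its language $\mathcal{L}_\omega(\mathcal{A})$ is the set of all $w=a_1a_2a_3\cdots\in\Sigma^\omega$ for which there is a run $q_0q_1q_2\cdots$ with $q_0\in Q_0$, $q_{i+1}\in\delta(q_i,a_{i+1})$ for all $i\ge 0$, and $q_i\in F$ for infinitely many $i$. Assume that $\mathcal{A}$ is strongly connected (for all $p,q\in Q$ there is $x\in\Sigma^*$ with $q\in\delta(p,x)$) and that $F\neq\varnothing$. Then the two sets below are measurable (the first with respect to the completion of $\mathrm{Pr}$) and $$ \mathrm{Pr}(\mathcal{L}_\omega(\mathcal{A}))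 \;=\; 1-\mathrm{Pr}\bigl\{\,w\in\Sigma^\omega : w \text{ has a finite prefix } x \text{ with } \delta(Q_0,x)=\varnothing\,\bigr\}. $$ In particular, $\mathcal{A}$ is almost universal, i.e. $\mathrm{Pr}(\mathcal{L}_\omega(\mathcal{A}))=1$, if and only if $\delta(Q_0,x)\neq\varnothing$ for all finite words $x\in\Sigma^*$. -/

import Mathlib

open MeasureTheory Filter

/-- The uniform probability measure on the infinite words over a finite nonempty alphabet: the
letters are independent and uniformly distributed. -/
noncomputable def uniformWordMeasure (α : Type*) [Fintype α] [Nonempty α] [MeasurableSpace α] :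
    Measure (ℕ → α) :=
  Measure.infinitePi fun _ : ℕ => (PMF.uniformOfFintype α).toMeasure

/-- The finite word `x` is a prefix (possibly empty) of the infinite word `w`. -/
def IsFinitePrefix {α : Type*} (x : List α) (w : ℕ → α) : Prop :=
  ∃ n : ℕ, x = (List.range n).map w

/-- A nondeterministic Büchi automaton has the same syntax as a nondeterministic finite automaton:
a transition function `step : σ → α → Set σ`, a set `start` of initial states and a set `accept`
of final states. The transition function extended to sets of states and finite words is
`NFA.evalFrom`. -/
abbrev NBA (α σ : Type*) := NFA α σ

namespace NBA

/-- `ρ` is a run of `A` for the infinite word `w`. -/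
def IsRun {α σ : Type*} (A : NBA α σ) (w : ℕ → α) (ρ : ℕ → σ) : Prop :=
  ρ 0 ∈ A.start ∧ ∀ i, ρ (i + 1) ∈ A.step (ρ i) (w i)

/-- The accepted language of infinite words: some run visits the final states infinitely often. -/
def omegaLanguage {α σ : Type*} (A : NBA α σ) : Set (ℕ → α) :=
  {w | ∃ ρ, A.IsRun w ρ ∧ ∃ᶠ i in atTop, ρ i ∈ A.accept}

/-- Every state is reachable from every state by some finite word. -/
def StronglyConnected {α σ : Type*} (A : NBA α σ) : Prop :=
  ∀ p q : σ, ∃ x : List α, q ∈ A.evalFrom {p} x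

/-- The infinite words that have a finite prefix on which the automaton gets stuck, that is,
after which no state is reached from the initial states. -/
def blockedWords {α σ : Type*} (A : NBA α σ) : Set (ℕ → α) :=
  {w | ∃ x : List α, IsFinitePrefix x w ∧ A.evalFrom A.start x = ∅}

/-- The accepted language has probability one. -/
def AlmostUniversal {α σ : Type*} [Fintype α] [Nonempty α] [MeasurableSpace α]
    (A : NBA α σ) : Prop :=
  (uniformWordMeasure α).real A.omegaLanguage = 1

end NBA

/-!
In a live set of states that is minimal for inclusion, fix a state `q`. From `q` some word leads
through a final state back to `q`, and a further word that blocks all the other states of the set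
makes everything alive afterwards come from that visit. Hence every set of states either is killed
by some word, or has a word along which a final visit stays alive forever. Treating the finitely
many sets of states one after the other gives a single word `x` that does this for all of them.

Almost surely `x` occurs infinitely often in a random word `w`, by the second Borel–Cantelli lemma
applied to disjoint blocks. For such a `w`, every state that survives along `w` reaches a final
state that survives as well. A walk through surviving states that always approaches the nearest
surviving final state is therefore an accepting run, and it exists as soon as `w` is not blocked.
-/

/-- The factor `w t, w (t + 1), …, w (t + n - 1)` of the infinite word `w`. -/
def wordFactor {α : Type*} (w : ℕ → α) (t n : ℕ) : List α :=
  (List.range' t n).map w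

section WordFactor

variable {α : Type*} (w : ℕ → α)

theorem wordFactor_succ (t n : ℕ) :
    wordFactor w t (n + 1) = w t :: wordFactor w (t + 1) n := rfl

theorem wordFactor_add (t m n : ℕ) :
    wordFactor w t (m + n) = wordFactor w t m ++ wordFactor w (t + m) n := by
  simp [wordFactor, ← List.range'_append_1]

theorem wordFactor_eq_append_iff (t : ℕ) (u v : List α) :
    wordFactor w t (u ++ v).length = u ++ v ↔
      wordFactor w t u.length = u ∧ wordFactor w (t + u.length) v.length = v := by
  rw [List.length_append, wordFactor_add]
  exact ⟨fun h => List.append_inj h (by simp [wordFactor]), fun ⟨hu, hv⟩ => by rw [hu, hv]⟩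

theorem wordFactor_length_eq_iff (t : ℕ) (x : List α) :
    wordFactor w t x.length = x ↔ (fun i : Fin x.length => w (t + i)) = x.get := by
  have hofFn : wordFactor w t x.length = List.ofFn fun i : Fin x.length => w (t + i) :=
    List.ext_getElem (by simp [wordFactor]) fun i _ _ => by simp [wordFactor]
  rw [← List.ofFn_injective.eq_iff, List.ofFn_get, hofFn]

theorem isFinitePrefix_iff_wordFactor_eq (x : List α) :
    IsFinitePrefix x w ↔ wordFactor w 0 x.length = x := by
  simp only [IsFinitePrefix, wordFactor, ← List.range_eq_range']
  refine ⟨?_, fun h => ⟨x.length, h.symm⟩⟩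
  rintro ⟨n, rfl⟩
  simp

end WordFactor

theorem exists_seq_frequently_mem_of_rank {X β : Type*} [LT β] [WellFoundedLT β]
    {r : X → X → Prop} {G : Set X} (rank : X → β)
    (h : ∀ x, ∃ y, r x y ∧ (x ∉ G → rank y < rank x)) (x₀ : X) :
    ∃ u : ℕ → X, u 0 = x₀ ∧ (∀ i, r (u i) (u (i + 1))) ∧ ∃ᶠ i in atTop, u i ∈ G := by
  choose next hnext hrank using h
  set u : ℕ → X := fun i => next^[i] x₀
  have hu (i : ℕ) : u (i + 1) = next (u i) := Function.iterate_succ_apply' next i x₀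
  refine ⟨u, rfl, fun i => hu i ▸ hnext (u i), frequently_atTop.2 fun a => ?_⟩
  induction hb : rank (u a) using WellFoundedLT.induction generalizing a with
  | ind b ih =>
    by_cases ha : u a ∈ G
    · exact ⟨a, le_rfl, ha⟩
    · obtain ⟨i, hi, hiG⟩ := ih _ (hb ▸ hu a ▸ hrank (u a) ha) (a + 1) rfl
      exact ⟨i, (Nat.le_succ a).trans hi, hiG⟩

/-- The law of an infinite word whose letters are independent with law `ν`. -/
noncomputable abbrev iidWordMeasure {α : Type*} [MeasurableSpace α] (ν : Measure α) :
    Measure (ℕ → α) :=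
  Measure.infinitePi fun _ : ℕ => ν

section IidWordMeasure

variable {α : Type*} [MeasurableSpace α] (ν : Measure α) [IsProbabilityMeasure ν]

theorem iidWordMeasure_ae_frequently_mem {B : Set α} (hB : MeasurableSet B) (hνB : ν B ≠ 0) :
    ∀ᵐ w ∂iidWordMeasure ν, ∃ᶠ k in atTop, w k ∈ B := by
  let E (k : ℕ) : Set (ℕ → α) := (fun w => w k) ⁻¹' B
  have hE (k : ℕ) : MeasurableSet (E k) := hB.preimage (measurable_pi_apply k)
  have hindep : ProbabilityTheory.iIndepSet E (iidWordMeasure ν) :=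
    (ProbabilityTheory.iIndepSet_iff_meas_biInter hE).2 fun s =>
      (ProbabilityTheory.iIndepFun_infinitePi (X := fun _ => id)
        fun _ => measurable_id).measure_inter_preimage_eq_mul s fun _ _ => hB
  have hmeasure (k : ℕ) : iidWordMeasure ν (E k) = ν B :=
    (measurePreserving_eval_infinitePi (fun _ : ℕ => ν) k).measure_preimage hB.nullMeasurableSet
  have hlimsup : iidWordMeasure ν (limsup E atTop) = 1 := by
    refine ProbabilityTheory.measure_limsup_eq_one hE hindep ?_
    simp only [hmeasure, ENNReal.tsum_const_eq_top_of_ne_zero hνB]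
  filter_upwards [(mem_ae_iff_prob_eq_one (MeasurableSet.measurableSet_limsup hE)).2 hlimsup]
    with w hw
  exact mem_limsup_iff_frequently_mem.1 hw

theorem iidWordMeasure_map_blocks (n : ℕ) [NeZero n] :
    (iidWordMeasure ν).map (fun w (k : ℕ) (i : Fin n) => w (k * n + i)) =
      iidWordMeasure (Measure.infinitePi fun _ : Fin n => ν) := by
  rw [iidWordMeasure, iidWordMeasure,
    ← Measure.infinitePi_map_curry (fun (_ : ℕ) (_ : Fin n) => ν),
    ← Measure.map_infinitePi_infinitePi_of_inj (P := fun _ : ℕ => ν)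
      (Nat.divModEquiv n).symm.injective,
    Measure.map_map (by fun_prop) (by fun_prop)]
  rfl

variable [MeasurableSingletonClass α]

theorem measurableSet_wordFactor_eq (t : ℕ) (x : List α) :
    MeasurableSet {w : ℕ → α | wordFactor w t x.length = x} := by
  simp only [wordFactor_length_eq_iff]
  exact (measurableSet_singleton x.get).preimage
    (measurable_pi_lambda _ fun i => measurable_pi_apply (t + i))

theorem iidWordMeasure_wordFactor_eq (t : ℕ) (x : List α) :
    iidWordMeasure ν {w | wordFactor w t x.length = x} = (x.map fun a => ν {a}).prod := by
  have hinj : Function.Injective fun i : Fin x.length => t + (i : ℕ) :=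
    (add_right_injective t).comp Fin.val_injective
  calc iidWordMeasure ν {w | wordFactor w t x.length = x}
      = (iidWordMeasure ν).map (fun w (i : Fin x.length) => w (t + i)) {x.get} := by
        rw [Measure.map_apply (by fun_prop) (measurableSet_singleton _)]
        simp only [wordFactor_length_eq_iff]
        rfl
    _ = ∏ i : Fin x.length, ν {x.get i} := by
        rw [Measure.map_infinitePi_infinitePi_of_inj hinj,
          Measure.infinitePi_singleton_of_fintype]
    _ = (x.map fun a => ν {a}).prod := Fin.prod_univ_fun_getElem x fun a => ν {a}

variable {ν}

theorem iidWordMeasure_ae_frequently_wordFactor_eq (x : List α) (hx : ∀ a ∈ x, ν {a} ≠ 0) :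
    ∀ᵐ w ∂iidWordMeasure ν, ∃ᶠ t in atTop, wordFactor w t x.length = x := by
  rcases eq_or_ne x [] with rfl | hne
  · exact .of_forall fun w => .of_forall fun t => rfl
  have : NeZero x.length := ⟨(List.length_pos_of_ne_nil hne).ne'⟩
  have hpos : Measure.infinitePi (fun _ : Fin x.length => ν) {x.get} ≠ 0 := by
    rw [Measure.infinitePi_singleton_of_fintype]
    exact Finset.prod_ne_zero_iff.2 fun i _ => hx _ (x.get_mem i)
  have hblocks := iidWordMeasure_ae_frequently_mem _ (measurableSet_singleton x.get) hpos
  rw [← iidWordMeasure_map_blocks] at hblocks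
  filter_upwards [ae_of_ae_map (Measurable.aemeasurable (by fun_prop)) hblocks] with w hw
  exact (tendsto_id.atTop_mul_const' (NeZero.pos x.length)).frequently
    (hw.mono fun k hk => (wordFactor_length_eq_iff w _ x).2 hk)

end IidWordMeasure

namespace NBA

variable {α σ : Type*} {A : NBA α σ} {S T : Set σ} {w : ℕ → α} {t : ℕ}

theorem evalFrom_mono (h : S ⊆ T) (x : List α) : A.evalFrom S x ⊆ A.evalFrom T x := by
  rw [← Set.union_eq_self_of_subset_left h, NFA.evalFrom_union]
  exact Set.subset_union_left

theorem evalFrom_singleton_subset {q : σ} (hq : q ∈ S) (x : List α) :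
    A.evalFrom {q} x ⊆ A.evalFrom S x :=
  evalFrom_mono (Set.singleton_subset_iff.2 hq) x

theorem evalFrom_empty (x : List α) : A.evalFrom ∅ x = ∅ := by
  rw [NFA.evalFrom_eq_biUnion_singleton, Set.biUnion_empty]

theorem evalFrom_nonempty_of_append {x y : List α} (h : (A.evalFrom S (x ++ y)).Nonempty) :
    (A.evalFrom S x).Nonempty := by
  by_contra hx
  rw [NFA.evalFrom_append, Set.not_nonempty_iff_eq_empty.1 hx, evalFrom_empty] at h
  exact Set.not_nonempty_empty h

/-- A set of states is live if no finite word leads from it to the empty set. -/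
def Live (A : NBA α σ) (S : Set σ) : Prop :=
  ∀ x : List α, (A.evalFrom S x).Nonempty

theorem Live.mono (hS : A.Live S) (h : S ⊆ T) : A.Live T :=
  fun x => (hS x).mono (evalFrom_mono h x)

theorem Live.evalFrom (hS : A.Live S) (x : List α) : A.Live (A.evalFrom S x) := fun y => by
  rw [← NFA.evalFrom_append]
  exact hS (x ++ y)

theorem exists_evalFrom_eq_empty_of_not_live (hS : ¬ A.Live S) : ∃ x, A.evalFrom S x = ∅ := by
  simpa only [Live, not_forall, Set.not_nonempty_iff_eq_empty] using hS

/-- Every strongly connected component of `A` contains a final state. As `x` and `y` may be empty,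
a final state without loops is a component of its own and meets the condition. -/
def AcceptingComponents (A : NBA α σ) : Prop :=
  ∀ q, ∃ f ∈ A.accept, ∃ x y, f ∈ A.evalFrom {q} x ∧ q ∈ A.evalFrom {f} y

theorem StronglyConnected.acceptingComponents (hA : A.StronglyConnected)
    (hF : A.accept.Nonempty) : A.AcceptingComponents := by
  obtain ⟨f, hf⟩ := hF
  intro q
  obtain ⟨x, hx⟩ := hA q f
  obtain ⟨y, hy⟩ := hA f q
  exact ⟨f, hf, x, y, hx, hy⟩

/-- The word `x` resolves `S` if it either leads from `S` to the empty set, or can be cut in two so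
that the final states reached at the cut lead to a live set along the second part. -/
def Resolves (A : NBA α σ) (x : List α) (S : Set σ) : Prop :=
  A.evalFrom S x = ∅ ∨ ∃ u v, u ++ v = x ∧ A.Live (A.evalFrom (A.evalFrom S u ∩ A.accept) v)

theorem Resolves.append_right {x : List α} (h : A.Resolves x S) (y : List α) :
    A.Resolves (x ++ y) S := by
  rcases h with h | ⟨u, v, rfl, h⟩
  · left
    rw [NFA.evalFrom_append, h, evalFrom_empty]
  · right
    refine ⟨u, v ++ y, (List.append_assoc u v y).symm, ?_⟩
    rw [NFA.evalFrom_append]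
    exact h.evalFrom y

theorem Resolves.append_left {x y : List α} (h : A.Resolves y (A.evalFrom S x)) :
    A.Resolves (x ++ y) S := by
  rcases h with h | ⟨u, v, rfl, h⟩
  · left
    rw [NFA.evalFrom_append, h]
  · right
    refine ⟨x ++ u, v, List.append_assoc x u v, ?_⟩
    rwa [NFA.evalFrom_append]

/- All liveness of a minimal live set `T` passes through each of its states `q`: a word that blocks
`T \ {q}` leads from `q` alone to everything it leads to from `T`. -/
theorem Live.exists_resolves [Finite σ] (hA : A.AcceptingComponents) (hS : A.Live S) :
    ∃ x, A.Resolves x S := by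
  obtain ⟨T, hTS, hT⟩ := (Set.toFinite {T | A.Live T}).exists_le_minimal hS
  obtain ⟨q, hq⟩ : T.Nonempty := hT.prop []
  have hdiff : ¬ A.Live (T \ {q}) := fun h => (hT.le_of_le h Set.sdiff_subset hq).2 rfl
  obtain ⟨z, hz⟩ := exists_evalFrom_eq_empty_of_not_live hdiff
  have hqz : A.evalFrom {q} z = A.evalFrom T z := by
    rw [← Set.sdiff_union_of_subset (Set.singleton_subset_iff.2 hq), NFA.evalFrom_union, hz,
      Set.empty_union]
  obtain ⟨f, hf, x, y, hx, hy⟩ := hA q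
  have hfx : f ∈ A.evalFrom S x ∩ A.accept := ⟨evalFrom_singleton_subset (hTS hq) x hx, hf⟩
  have hqxy : q ∈ A.evalFrom (A.evalFrom S x ∩ A.accept) y := evalFrom_singleton_subset hfx y hy
  refine ⟨x ++ (y ++ z), .inr ⟨x, y ++ z, rfl, ?_⟩⟩
  rw [NFA.evalFrom_append]
  exact (hqz ▸ hT.prop.evalFrom z).mono (evalFrom_singleton_subset hqxy z)

theorem exists_resolves [Finite σ] (hA : A.AcceptingComponents) (S : Set σ) :
    ∃ x, A.Resolves x S := by
  by_cases hS : A.Live S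
  · exact hS.exists_resolves hA
  · exact (exists_evalFrom_eq_empty_of_not_live hS).imp fun _ => .inl

theorem exists_forall_resolves [Finite σ] (hA : A.AcceptingComponents) :
    ∃ x, ∀ S, A.Resolves x S := by
  have hfamily (C : Set (Set σ)) : ∃ x, ∀ S ∈ C, A.Resolves x S := by
    induction C, C.toFinite using Set.Finite.induction_on with
    | empty => exact ⟨[], fun S hS => hS.elim⟩
    | @insert S C _ _ ih =>
      obtain ⟨x, hx⟩ := ih
      obtain ⟨y, hy⟩ := exists_resolves hA (A.evalFrom S x)
      exact ⟨x ++ y, Set.forall_mem_insert.2 ⟨hy.append_left, fun T hT => (hx T hT).append_right y⟩⟩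
  simpa using hfamily Set.univ

/-- The set `S` of states, entered at time `t`, never becomes empty while `w` is read. -/
def Survives (A : NBA α σ) (w : ℕ → α) (t : ℕ) (S : Set σ) : Prop :=
  ∀ n, (A.evalFrom S (wordFactor w t n)).Nonempty

theorem Survives.mono (hS : A.Survives w t S) (h : S ⊆ T) : A.Survives w t T :=
  fun n => (hS n).mono (evalFrom_mono h _)

theorem Live.survives (hS : A.Live S) (w : ℕ → α) (t : ℕ) : A.Survives w t S :=
  fun n => hS (wordFactor w t n)

theorem evalFrom_wordFactor_nonempty_of_le {m n : ℕ} (hmn : m ≤ n)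
    (h : (A.evalFrom S (wordFactor w t n)).Nonempty) :
    (A.evalFrom S (wordFactor w t m)).Nonempty := by
  obtain ⟨k, rfl⟩ := Nat.exists_eq_add_of_le hmn
  rw [wordFactor_add] at h
  exact evalFrom_nonempty_of_append h

theorem survives_evalFrom_iff (n : ℕ) :
    A.Survives w (t + n) (A.evalFrom S (wordFactor w t n)) ↔ A.Survives w t S := by
  simp only [Survives, ← NFA.evalFrom_append, ← wordFactor_add]
  exact ⟨fun h m => evalFrom_wordFactor_nonempty_of_le (Nat.le_add_left m n) (h m),
    fun h m => h (n + m)⟩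

theorem Survives.exists_singleton [Finite σ] (hS : A.Survives w t S) :
    ∃ q ∈ S, A.Survives w t {q} := by
  have hfreq : ∃ᶠ n in atTop, ∃ q ∈ S, (A.evalFrom {q} (wordFactor w t n)).Nonempty :=
    .of_forall fun n => by
      simpa only [NFA.evalFrom_eq_biUnion_singleton A S, Set.nonempty_biUnion] using hS n
  obtain ⟨q, hq, hqfreq⟩ := (frequently_exists_finite S.toFinite).1 hfreq
  refine ⟨q, hq, fun m => ?_⟩
  obtain ⟨n, hmn, hn⟩ := frequently_atTop.1 hqfreq m
  exact evalFrom_wordFactor_nonempty_of_le hmn hn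

theorem Survives.exists_step [Finite σ] {q : σ} (hq : A.Survives w t {q}) :
    ∃ p ∈ A.step q (w t), A.Survives w (t + 1) {p} := by
  rw [← survives_evalFrom_iff 1] at hq
  simpa [wordFactor] using hq.exists_singleton

theorem Survives.exists_step_of_mem_evalFrom {q f : σ} {n : ℕ} (hf : A.Survives w (t + (n + 1)) {f})
    (hqf : f ∈ A.evalFrom {q} (wordFactor w t (n + 1))) :
    ∃ p ∈ A.step q (w t), A.Survives w (t + 1) {p} ∧
      f ∈ A.evalFrom {p} (wordFactor w (t + 1) n) := by
  rw [wordFactor_succ, NFA.evalFrom_cons, NFA.stepSet_singleton,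
    NFA.mem_evalFrom_iff_exists] at hqf
  obtain ⟨p, hp, hpf⟩ := hqf
  rw [add_comm n, ← add_assoc] at hf
  exact ⟨p, hp, (survives_evalFrom_iff n).1 (hf.mono (Set.singleton_subset_iff.2 hpf)), hpf⟩

theorem Survives.exists_accept [Finite σ] {x : List α} (hx : ∀ S, A.Resolves x S)
    (hw : ∃ᶠ t in atTop, wordFactor w t x.length = x) (hS : A.Survives w t S) :
    ∃ n, ∃ f ∈ A.evalFrom S (wordFactor w t n) ∩ A.accept, A.Survives w (t + n) {f} := by
  obtain ⟨s, hts, hs⟩ := frequently_atTop.1 hw t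
  obtain ⟨m, rfl⟩ := Nat.exists_eq_add_of_le hts
  have hne := (survives_evalFrom_iff m).2 hS x.length
  rw [hs] at hne
  obtain ⟨u, v, rfl, hlive⟩ := (hx _).resolve_left hne.ne_empty
  obtain ⟨hu, hv⟩ := (wordFactor_eq_append_iff w _ u v).1 hs
  have hsurv : A.Survives w (t + m + u.length)
      (A.evalFrom (A.evalFrom S (wordFactor w t m)) u ∩ A.accept) := by
    rw [← survives_evalFrom_iff v.length, hv]
    exact hlive.survives w _
  refine ⟨m + u.length, ?_⟩
  rw [wordFactor_add, hu, NFA.evalFrom_append, ← add_assoc]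
  exact hsurv.exists_singleton

theorem mem_omegaLanguage_of_survives [Finite σ] {x : List α} (hx : ∀ S, A.Resolves x S)
    (hw : ∃ᶠ t in atTop, wordFactor w t x.length = x) (hstart : A.Survives w 0 A.start) :
    w ∈ A.omegaLanguage := by
  classical
  let X := {p : ℕ × σ // A.Survives w p.1 {p.2}}
  have hacc (p : X) := p.2.exists_accept hx hw
  let rank (p : X) : ℕ := Nat.find (hacc p)
  have hnext (p : X) : ∃ p' : X, (p'.1.1 = p.1.1 + 1 ∧ p'.1.2 ∈ A.step p.1.2 (w p.1.1)) ∧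
      (p ∉ {p : X | p.1.2 ∈ A.accept} → rank p' < rank p) := by
    obtain ⟨f, ⟨hf, hfacc⟩, hfsurv⟩ := Nat.find_spec (hacc p)
    rcases hrank : Nat.find (hacc p) with _ | n
    · rw [hrank] at hf
      obtain ⟨q, hq, hqsurv⟩ := p.2.exists_step
      obtain rfl : f = p.1.2 := hf
      exact ⟨⟨(p.1.1 + 1, q), hqsurv⟩, ⟨rfl, hq⟩, fun hp => (hp hfacc).elim⟩
    · rw [hrank] at hf hfsurv
      obtain ⟨q, hq, hqsurv, hqf⟩ := hfsurv.exists_step_of_mem_evalFrom hf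
      have hfq : A.Survives w (p.1.1 + 1 + n) {f} := by rwa [add_right_comm]
      exact ⟨⟨(p.1.1 + 1, q), hqsurv⟩, ⟨rfl, hq⟩, fun _ => by
        rw [show rank p = n + 1 from hrank, Nat.lt_succ_iff]
        exact Nat.find_min' _ ⟨f, ⟨hqf, hfacc⟩, hfq⟩⟩
  obtain ⟨q, hq, hqsurv⟩ := hstart.exists_singleton
  obtain ⟨u, hu₀, hstep, hfreq⟩ := exists_seq_frequently_mem_of_rank rank hnext ⟨(0, q), hqsurv⟩
  have htime (i : ℕ) : (u i).1.1 = i := by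
    induction i with
    | zero => rw [hu₀]
    | succ i ih => rw [(hstep i).1, ih]
  refine ⟨fun i => (u i).1.2, ⟨by simpa only [hu₀] using hq, fun i => ?_⟩, hfreq⟩
  simpa only [htime] using (hstep i).2

theorem IsRun.survives {ρ : ℕ → σ} (hρ : A.IsRun w ρ) : A.Survives w 0 A.start := by
  intro n
  refine ⟨ρ n, ?_⟩
  induction n with
  | zero => exact hρ.1
  | succ n ih =>
    rw [wordFactor_add, NFA.evalFrom_append, zero_add]
    exact NFA.mem_stepSet.2 ⟨ρ n, ih, hρ.2 n⟩

theorem notMem_blockedWords_iff : w ∉ A.blockedWords ↔ A.Survives w 0 A.start := by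
  simp [blockedWords, IsFinitePrefix, Survives, wordFactor, List.range_eq_range',
    Set.nonempty_iff_ne_empty]

section Measure

variable [MeasurableSpace α] [MeasurableSingletonClass α]

theorem measurableSet_blockedWords [Countable α] : MeasurableSet A.blockedWords := by
  have hunion : A.blockedWords = ⋃ x ∈ {x : List α | A.evalFrom A.start x = ∅},
      {w | wordFactor w 0 x.length = x} := by
    ext w
    simp [blockedWords, isFinitePrefix_iff_wordFactor_eq, and_comm]
  rw [hunion]
  exact MeasurableSet.biUnion (Set.to_countable _) fun x _ => measurableSet_wordFactor_eq 0 x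

variable {ν : Measure α} [IsProbabilityMeasure ν]

theorem omegaLanguage_ae_eq_compl_blockedWords [Finite σ] (hν : ∀ a, ν {a} ≠ 0)
    (hA : A.AcceptingComponents) :
    A.omegaLanguage =ᵐ[iidWordMeasure ν] (A.blockedWordsᶜ : Set (ℕ → α)) := by
  obtain ⟨x, hx⟩ := exists_forall_resolves hA
  rw [eventuallyEq_set]
  filter_upwards [iidWordMeasure_ae_frequently_wordFactor_eq x fun a _ => hν a] with w hw
  rw [Set.mem_compl_iff, notMem_blockedWords_iff]
  exact ⟨fun ⟨_, hρ, _⟩ => hρ.survives, mem_omegaLanguage_of_survives hx hw⟩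

theorem iidWordMeasure_blockedWords_eq_zero_iff (hν : ∀ a, ν {a} ≠ 0) :
    iidWordMeasure ν A.blockedWords = 0 ↔ ∀ x, A.evalFrom A.start x ≠ ∅ := by
  constructor
  · intro hzero x hx
    have hprefix : {w | wordFactor w 0 x.length = x} ⊆ A.blockedWords := fun w hw =>
      ⟨x, (isFinitePrefix_iff_wordFactor_eq w x).2 hw, hx⟩
    have hprod := measure_mono_null hprefix hzero
    rw [iidWordMeasure_wordFactor_eq, List.prod_eq_zero_iff, List.mem_map] at hprod
    obtain ⟨a, -, ha⟩ := hprod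
    exact hν a ha
  · intro hne
    have hempty : A.blockedWords = ∅ :=
      Set.eq_empty_of_forall_notMem fun w ⟨x, _, hx⟩ => hne x hx
    rw [hempty, measure_empty]

end Measure

end NBA

theorem toMeasure_uniformOfFintype_singleton_ne_zero {α : Type*} [Fintype α] [Nonempty α]
    [MeasurableSpace α] [MeasurableSingletonClass α] (a : α) :
    (PMF.uniformOfFintype α).toMeasure {a} ≠ 0 := by
  rw [PMF.toMeasure_apply_singleton _ _ (measurableSet_singleton a)]
  simp

theorem mainTheorem8_general {α σ : Type*} [Countable α] [MeasurableSpace α]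
    [MeasurableSingletonClass α] [Finite σ] (ν : Measure α) [IsProbabilityMeasure ν]
    (hν : ∀ a, ν {a} ≠ 0) (A : NBA α σ) (hA : A.AcceptingComponents) :
    NullMeasurableSet A.omegaLanguage (iidWordMeasure ν) ∧
    MeasurableSet A.blockedWords ∧
    (iidWordMeasure ν).real A.omegaLanguage = 1 - (iidWordMeasure ν).real A.blockedWords ∧
    ((iidWordMeasure ν).real A.omegaLanguage = 1 ↔ ∀ x : List α, A.evalFrom A.start x ≠ ∅) := by
  have hae := NBA.omegaLanguage_ae_eq_compl_blockedWords hν hA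
  have hmeas : MeasurableSet A.blockedWords := NBA.measurableSet_blockedWords
  have hprob : (iidWordMeasure ν).real A.omegaLanguage =
      1 - (iidWordMeasure ν).real A.blockedWords := by
    rw [measureReal_congr hae, probReal_compl_eq_one_sub hmeas]
  refine ⟨hmeas.compl.nullMeasurableSet.congr hae.symm, hmeas, hprob, ?_⟩
  rw [hprob, sub_eq_self, measureReal_eq_zero_iff, NBA.iidWordMeasure_blockedWords_eq_zero_iff hν]

theorem mainTheorem8 {α σ : Type*} [Fintype α] [Nonempty α] [MeasurableSpace α]
    [MeasurableSingletonClass α] [Finite σ] (A : NBA α σ)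
    (hA : A.StronglyConnected) (hF : A.accept.Nonempty) :
    NullMeasurableSet A.omegaLanguage (uniformWordMeasure α) ∧
    MeasurableSet A.blockedWords ∧
    (uniformWordMeasure α).real A.omegaLanguage =
      1 - (uniformWordMeasure α).real A.blockedWords ∧
    (A.AlmostUniversal ↔ ∀ x : List α, A.evalFrom A.start x ≠ ∅) :=
  mainTheorem8_general _ toMeasure_uniformOfFintype_singleton_ne_zero A
    (hA.acceptingComponents hF)
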